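/- Let $\mathcal H$ be an infinite-dimensional separable complex Hilbert space, let $\mathcal L(\mathcal H)$ be the algebra of bounded operators on $\mathcal H$, let $\Omega\subset\mathbb C$ be open, bounded and connected, and let $n\in\mathbb N$. Definitions. A bounded operator $T$ on a Hilbert space $\mathcal E$ is in $\mathcal B_n(\Omega)$ if for every $w\in\Omega$ the operator $T-w$ is surjective with $\dim\operatorname{Ker}(T-w)=n$, and $\bigvee_{w\in\Omega}\operatorname{Ker}(T-w)=\mathcal E$. An ordered pair $(A,B)$ of bounded operators has Property (H) if $X=0$ whenever $AX=XB$ and $X=AZ-ZB$ for some bounded $Z$. A topological direct decomposition $\mathcal H=\mathcal H_1\dotplus\cdots\dotplus\mathcal H_n$ is given by bounded idempotents $P_1,\dots,P_n$ with $\sum_j P_j=I$, $P_kP_j=0$ for $k\ne j$ and $\mathcal H_j=\operatorname{Ran}P_j$; the entry $T_{k,j}:\mathcal H_j\to\mathcal H_k$ of an operator $T$ is the restriction of $P_kT$ to $\mathcal H_j$. An operator $T\in\mathcal L(\mathcal H)$ is in $\mathcal{NCFB}_n(\Omega)$, with admissible decomposition $P_1,\dots,P_n$, if 1. $T\in\mathcal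 B_n(\Omega)$, and $T^*T-TT^*$ and all $P_j^*-P_j$ are compact; 2. $T_{k,j}=0$ for $k>j$, $T_{j,j}\in\mathcal B_1(\Omega)$ for all $j$, and $\operatorname{Diag}T=\sum_jP_jTP_j$ commutes with $T$; 3. for $k\le j$ there is a bounded operator $C_{k,j}$ on $\mathcal H_k$ commuting with $T_{k,k}$ such that $T_{k,j}=C_{k,j}T_{k,k+1}T_{k+1,k+2}\cdots T_{j-1,j}$; 4. $(T_{j,j},T_{j+1,j+1})$ has Property (H) for $1\le j\le n-1$. $T$ is strongly irreducible if the only idempotents in $\mathcal L(\mathcal H)$ commuting with $T$ are $0$ and $I$. Proposition. Let $T,\widetilde T\in\mathcal{NCFB}_n(\Omega)$, with admissible decompositions $P_1,\dots,P_n$ and $\widetilde P_1,\dots,\widetilde P_n$ respectively, let $T$ be strongly irreducible, and let $X\in\mathcal L(\mathcal H)$ be invertible with $XT=\widetilde TX$. Then $X$ and $X^{-1}$ are upper triangular with respect to these decompositions: $\widetilde P_kXP_j=0$ and $P_kX^{-1}\widetilde P_j=0$ for all $k>j$. -/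

import Mathlib

/-- The Cowen-Douglas class `B_n(Ω)`: `T - w` is onto and has an `n`-dimensional kernel for all
`w ∈ Ω`, and these kernels together span a dense subspace. -/
structure IsCowenDouglas {E : Type*} [NormedAddCommGroup E] [NormedSpace ℂ E]
    (Ω : Set ℂ) (n : ℕ) (T : E →L[ℂ] E) : Prop where
  surjective : ∀ w ∈ Ω, Function.Surjective (T - w • ContinuousLinearMap.id ℂ E)
  rank_ker : ∀ w ∈ Ω,
    Module.rank ℂ (LinearMap.ker (T - w • ContinuousLinearMap.id ℂ E).toLinearMap) = n
  span_ker : (⨆ w ∈ Ω, LinearMap.ker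
    (T - w • ContinuousLinearMap.id ℂ E).toLinearMap).topologicalClosure = ⊤

/-- Property (H) of an ordered pair `(A, B)`: the kernel and the range of `Z ↦ A Z - Z B`
meet only in `0`. -/
def PropertyH {E F : Type*} [NormedAddCommGroup E] [NormedSpace ℂ E]
    [NormedAddCommGroup F] [NormedSpace ℂ F] (A : E →L[ℂ] E) (B : F →L[ℂ] F) : Prop :=
  ∀ X Z : F →L[ℂ] E, A ∘L X = X ∘L B → X = A ∘L Z - Z ∘L B → X = 0

section Blocks

variable {H : Type*} [NormedAddCommGroup H] [InnerProductSpace ℂ H]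

/-- There is no idempotent other than `0` and `1` in the commutant of `T`. -/
def IsStronglyIrreducible (T : H →L[ℂ] H) : Prop :=
  ∀ E : H →L[ℂ] H, E * E = E → E * T = T * E → E = 0 ∨ E = 1

/-- Bounded idempotents `P_j` with `P_k P_j = 0` for `k ≠ j` and `∑ P_j = 1`; equivalently the
topological direct decomposition of `H` into the closed subspaces `Ran P_j`. -/
structure IsDirectDecomposition {n : ℕ} (P : Fin n → H →L[ℂ] H) : Prop where
  idem : ∀ j, P j * P j = P j
  ortho : ∀ k j, k ≠ j → P k * P j = 0
  sum_eq : ∑ j, P j = 1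

/-- The summand `H_j = Ran P_j`. -/
abbrev Summand {n : ℕ} (P : Fin n → H →L[ℂ] H) (j : Fin n) : Submodule ℂ H :=
  LinearMap.range (P j).toLinearMap

/-- The `(k, j)` entry `A_{k,j} : Ran P_j → Ran Q_k` of the operator matrix of `A`, with respect to
the decomposition `P` of the domain and the decomposition `Q` of the target. -/
def block {n : ℕ} (Q P : Fin n → H →L[ℂ] H) (A : H →L[ℂ] H) (k j : Fin n) :
    Summand P j →L[ℂ] Summand Q k :=
  ((Q k ∘L A) ∘L (Summand P j).subtypeL).codRestrict (Summand Q k)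
    (fun x => ⟨A (x : H), rfl⟩)

/-- All entries strictly below the diagonal vanish. -/
def IsUpperTriangular {n : ℕ} (Q P : Fin n → H →L[ℂ] H) (A : H →L[ℂ] H) : Prop :=
  ∀ k j : Fin n, j < k → block Q P A k j = 0

/-- The diagonal of `T`, as an operator on `H`. -/
noncomputable def diagPart {n : ℕ} (P : Fin n → H →L[ℂ] H) (T : H →L[ℂ] H) : H →L[ℂ] H :=
  ∑ j, P j * T * P j

/-- The product `T_{k,k+1} T_{k+1,k+2} ⋯ T_{k+m-1,k+m}` (the identity of `Ran P_k` for `m = 0`). -/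
def superdiagProd {n : ℕ} (P : Fin n → H →L[ℂ] H) (T : H →L[ℂ] H) (k : Fin n) :
    (m : ℕ) → (h : (k : ℕ) + m < n) → (Summand P ⟨(k : ℕ) + m, h⟩ →L[ℂ] Summand P k)
  | 0, _ => ContinuousLinearMap.id ℂ (Summand P k)
  | m + 1, h =>
      (superdiagProd P T k m (Nat.lt_of_succ_lt h)) ∘L
        (block P P T ⟨(k : ℕ) + m, Nat.lt_of_succ_lt h⟩ ⟨(k : ℕ) + (m + 1), h⟩)

/-- `T ∈ CFB_n(Ω)` with respect to the decomposition given by `P`. -/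
structure IsCFB {n : ℕ} (Ω : Set ℂ) (P : Fin n → H →L[ℂ] H) (T : H →L[ℂ] H) : Prop where
  cowenDouglas : IsCowenDouglas Ω n T
  decomposition : IsDirectDecomposition P
  upper : IsUpperTriangular P P T
  diag_cowenDouglas : ∀ j, IsCowenDouglas Ω 1 (block P P T j j)
  diag_commute : diagPart P T * T = T * diagPart P T
  entry : ∀ (k : Fin n) (m : ℕ) (h : (k : ℕ) + m < n),
    ∃ C : Summand P k →L[ℂ] Summand P k,
      C ∘L block P P T k k = block P P T k k ∘L C ∧
      block P P T k ⟨(k : ℕ) + m, h⟩ = C ∘L superdiagProd P T k m h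
  propertyH : ∀ j k : Fin n, (k : ℕ) = (j : ℕ) + 1 →
    PropertyH (block P P T j j) (block P P T k k)

/-- `T ∈ NCFB_n(Ω)`, and `P` is a decomposition as in the definition of that class: `T` is
essentially normal, every `P_j` is self-adjoint modulo the compact operators, and
`T ∈ CFB_n(Ω)` with respect to `P`. -/
structure IsNCFB [CompleteSpace H] {n : ℕ} (Ω : Set ℂ) (P : Fin n → H →L[ℂ] H)
    (T : H →L[ℂ] H) : Prop where
  essNormal : IsCompactOperator
    (ContinuousLinearMap.adjoint T * T - T * ContinuousLinearMap.adjoint T)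
  essSelfAdjoint : ∀ j, IsCompactOperator (ContinuousLinearMap.adjoint (P j) - P j)
  cfb : IsCFB Ω P T

end Blocks

-- Write `T = D + N` with `D` the diagonal part; `N` is nilpotent and commutes with `D`. If a
-- superdiagonal entry of `T` vanished, so would every entry factoring through it, and `T` would
-- split; so none vanishes (`superdiag_ne_zero`). A nonzero intertwiner of operators in `B_1(Ω)` has
-- dense range, by analytic continuation of eigenvectors over `Ω` (`eq_zero_of_comp_eq_zero`), so
-- superdiagonal entries cancel on the right.
--
-- If `A` commutes with `T`, a power of `ad D` kills `A`. On a diagonal corner, Kleinecke-Shirokov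
-- (`eigenvalue_lie_eq_zero`) lowers that power to one: the commutator acts by a scalar on each
-- eigenline, and the scalar is `0`. Cancellation carries this below the diagonal and makes `A`
-- upper triangular, strictly so if `A` is nilpotent (`corner_eq_zero_of_nilpotent`).
--
-- For the intertwiner `X`, the operator `X N X⁻¹` is nilpotent and commutes with the second
-- operator, so its `m`-th power maps into the first `n - m` summands there. The range of `N ^ m` is
-- dense in the first `n - m` summands of the first decomposition, so `X` carries one flag into the
-- other (`corner_intertwiner_eq_zero`).

attribute [local instance] LieRing.ofAssociativeRing

/-- Operator matrices `D + N` over a ring, with `D` block diagonal, `N` strictly upper triangular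
and commuting with `D`, such that the superdiagonal entries of `N` can be cancelled on the right,
and such that the diagonal entries of `D` satisfy the Kleinecke-Shirokov property and have reduced
commutants. -/
structure IsFlagModel {R : Type*} [Ring R] {n : ℕ} (P : Fin n → R) (D N : R) : Prop where
  idem : ∀ j, P j * P j = P j
  ortho : ∀ k j, k ≠ j → P k * P j = 0
  sum_eq : ∑ j, P j = 1
  diag_comm : ∀ j, D * P j = P j * D
  commute : D * N = N * D
  upper : ∀ i j, j ≤ i → P i * N * P j = 0
  cancel : ∀ i j : Fin n, (j : ℕ) = i + 1 → ∀ Y, Y * P i * N * P j = 0 → Y * P i = 0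
  shirokov : ∀ i a, P i * a * P i = a → ⁅D, ⁅D, a⁆⁆ = 0 → ⁅D, a⁆ = 0
  reduced : ∀ i a, P i * a * P i = a → ⁅D, a⁆ = 0 → IsNilpotent a → a = 0

/-! ### Commutants and intertwiners of flag models, in a ring -/

namespace IsFlagModel

variable {R : Type*} [Ring R] {n : ℕ} {P : Fin n → R} {D N A : R}

lemma mul_eq_sum (h : IsFlagModel P D N) (a b : R) : a * b = ∑ l, a * P l * (P l * b) := by
  have : ∀ l, a * P l * (P l * b) = a * P l * b := fun l => by
    rw [← mul_assoc, mul_assoc a, h.idem]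
  simp_rw [this]
  rw [← Finset.sum_mul, ← Finset.mul_sum, h.sum_eq, mul_one]

lemma mul_eq_zero_of_forall (h : IsFlagModel P D N) {a b : R}
    (hl : ∀ l, a * P l = 0 ∨ P l * b = 0) : a * b = 0 := by
  rw [h.mul_eq_sum a b]
  exact Finset.sum_eq_zero fun l _ => by rcases hl l with h | h <;> simp [h]

lemma mul_eq_single (h : IsFlagModel P D N) {a b : R} (j : Fin n)
    (hl : ∀ l, l ≠ j → a * P l = 0 ∨ P l * b = 0) : a * b = a * P j * b := by
  rw [h.mul_eq_sum a b, Finset.sum_eq_single j, ← mul_assoc, mul_assoc a, h.idem]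
  · exact fun l _ hlj => by rcases hl l hlj with h | h <;> simp [h]
  · simp

lemma lie_corner (h : IsFlagModel P D N) (i j : Fin n) (a : R) :
    ⁅D, P i * a * P j⁆ = P i * ⁅D, a⁆ * P j := by
  simp only [Ring.lie_def, mul_sub, sub_mul]
  congr 1
  · simp only [← mul_assoc, h.diag_comm]
  · simp only [mul_assoc, h.diag_comm]

/-- The iterated commutators with `D` of the elements of the commutant of `D + N` vanish. -/
lemma lie_nilpotent (h : IsFlagModel P D N) (hN : IsNilpotent N)
    (hA : (D + N) * A = A * (D + N)) : ∃ m, (LieAlgebra.ad ℤ R D ^ m) A = 0 := by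
  -- At `A` the maps `ad D` and `-ad N` agree; since `ad D` and `ad N` commute, so do all their
  -- powers at `A`, and `ad N` is nilpotent.
  have hDA : ⁅D, A⁆ = -⁅N, A⁆ := by
    simp only [Ring.lie_def]
    rw [add_mul, mul_add] at hA
    rw [neg_sub, sub_eq_sub_iff_add_eq_add, hA, add_comm]
  have hpow : ∀ m, (LieAlgebra.ad ℤ R D ^ m) A = (-1) ^ m • (LieAlgebra.ad ℤ R N ^ m) A := by
    have hc : Commute (LieAlgebra.ad ℤ R D) (LieAlgebra.ad ℤ R N) :=
      LieAlgebra.commute_ad_of_commute h.commute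
    intro m
    induction m with
    | zero => simp
    | succ m ih =>
      rw [pow_succ', Module.End.mul_apply, ih, map_zsmul, ← Module.End.mul_apply,
        (hc.pow_right m).eq, Module.End.mul_apply, LieAlgebra.ad_apply, hDA,
        pow_succ (LieAlgebra.ad ℤ R N), Module.End.mul_apply, LieAlgebra.ad_apply, map_neg,
        pow_succ, mul_neg_one, neg_smul, smul_neg]
  obtain ⟨m, hm⟩ := LieAlgebra.ad_nilpotent_of_nilpotent (R := ℤ) hN
  exact ⟨m, by rw [hpow, hm]; simp⟩

/-- The entries on and below the diagonal of an element on which `ad D` is nilpotent intertwine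
the diagonal entries of `D`. -/
lemma lie_corner_eq_zero (h : IsFlagModel P D N) (hA : ∃ m, (LieAlgebra.ad ℤ R D ^ m) A = 0)
    {i j : Fin n} (hji : j ≤ i) : P i * ⁅D, A⁆ * P j = 0 := by
  obtain ⟨m, hm⟩ := hA
  obtain ⟨d, hd⟩ := Nat.exists_eq_add_of_le (Fin.le_def.mp hji)
  -- Induction on the distance from the diagonal. `A` varies because the step multiplies it by a
  -- superdiagonal entry of `N`.
  induction d generalizing A j with
  | zero =>
    obtain rfl : i = j := Fin.ext hd
    have hpow : ∀ k, P i * (LieAlgebra.ad ℤ R D ^ k) A * P i =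
        (LieAlgebra.ad ℤ R D ^ k) (P i * A * P i) := by
      intro k
      induction k with
      | zero => simp
      | succ k ih =>
        rw [pow_succ', Module.End.mul_apply, Module.End.mul_apply, ← ih, LieAlgebra.ad_apply,
          LieAlgebra.ad_apply, h.lie_corner]
    have hsupp : ∀ x, P i * (P i * x * P i) * P i = P i * x * P i := fun x => by
      simp only [mul_assoc, h.idem]
      simp only [← mul_assoc, h.idem]
    -- The Shirokov property lowers the exponent by one at a time, down to a single commutator.
    have key : ∀ k, (LieAlgebra.ad ℤ R D ^ (k + 1)) (P i * A * P i) = 0 →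
        ⁅D, P i * A * P i⁆ = 0 := by
      intro k
      induction k with
      | zero => simp
      | succ k ih =>
        intro hk
        refine ih ?_
        rw [pow_succ', Module.End.mul_apply, pow_succ', Module.End.mul_apply,
          LieAlgebra.ad_apply, LieAlgebra.ad_apply] at hk
        rw [pow_succ', Module.End.mul_apply, LieAlgebra.ad_apply]
        refine h.shirokov i _ ?_ hk
        rw [← hpow, hsupp]
    rw [← h.lie_corner]
    exact key m (by rw [pow_succ', Module.End.mul_apply, ← hpow, hm]; simp)
  | succ d ih =>
    let j' : Fin n := ⟨j + 1, by omega⟩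
    -- The entry `P j * N * P j'` commutes with `D`, so right multiplication by it commutes with `ad
    -- D`; it moves the question to column `j + 1`, and `cancel` brings the answer back.
    have hlie : ∀ a, ⁅D, a * (P j * N * P j')⁆ = ⁅D, a⁆ * (P j * N * P j') := by
      intro a
      have : ⁅D, P j * N * P j'⁆ = 0 := by
        rw [h.lie_corner, Ring.lie_def, h.commute]; simp
      rw [Ring.lie_def, sub_eq_zero] at this
      rw [Ring.lie_def, Ring.lie_def, sub_mul, mul_assoc a, ← this]
      simp only [mul_assoc]
    have hpow : ∀ k, (LieAlgebra.ad ℤ R D ^ k) (A * (P j * N * P j')) =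
        (LieAlgebra.ad ℤ R D ^ k) A * (P j * N * P j') := by
      intro k
      induction k with
      | zero => simp
      | succ k ih =>
        rw [pow_succ', Module.End.mul_apply, Module.End.mul_apply, ih, LieAlgebra.ad_apply,
          LieAlgebra.ad_apply, hlie]
    have := ih (A := A * (P j * N * P j')) (j := j') (by rw [Fin.le_def]; simp only [j']; omega)
      (by rw [hpow, hm, zero_mul]) (by simp only [j']; omega)
    rw [hlie] at this
    refine h.cancel j j' rfl _ ?_
    rw [← this]
    simp only [mul_assoc, h.idem]

/-- On and below the diagonal `[D, A] = A N - N A` vanishes. Going through rows from the bottom up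
and columns from left to right, its `(i, j + 1)` entry reduces to `A_{i,j} N_{j,j+1}`, and the
second factor cancels. -/
lemma corner_eq_zero_of_commute (h : IsFlagModel P D N) (hN : IsNilpotent N)
    (hA : (D + N) * A = A * (D + N)) {i j : Fin n} (hji : j < i) : P i * A * P j = 0 := by
  have hL := fun {i j : Fin n} => h.lie_corner_eq_zero (i := i) (j := j) (h.lie_nilpotent hN hA)
  have hDA : ⁅D, A⁆ = A * N - N * A := by
    rw [add_mul, mul_add] at hA
    rw [Ring.lie_def, sub_eq_sub_iff_add_eq_add, hA, add_comm]
  induction hr : n - (i : ℕ) using Nat.strong_induction_on generalizing i j with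
  | _ r ihr =>
  induction hc : (j : ℕ) using Nat.strong_induction_on generalizing j with
  | _ c ihc =>
  have hrow : ∀ l j : Fin n, i < l → j < l → P l * A * P j = 0 := fun l j hl hj =>
    ihr (n - l) (by omega) hj rfl
  have hcol : ∀ l : Fin n, l < j → P i * A * P l = 0 := fun l hl =>
    ihc l (by omega) (hl.trans hji) rfl
  let j' : Fin n := ⟨j + 1, by omega⟩
  have hj' : j' ≤ i := by rw [Fin.le_def]; simp only [j']; omega
  have h1 : P i * A * (N * P j') = P i * N * (A * P j') := by
    have := hL hj'
    rw [hDA, mul_sub, sub_mul, sub_eq_zero] at this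
    simpa only [mul_assoc] using this
  have h2 : P i * N * (A * P j') = 0 := by
    refine h.mul_eq_zero_of_forall fun l => ?_
    rcases le_or_gt l i with hl | hl
    · exact Or.inl (h.upper i l hl)
    · right
      rw [← mul_assoc]
      exact hrow l j' hl (lt_of_le_of_lt hj' hl)
  have h3 : P i * A * (N * P j') = P i * A * P j * (N * P j') := by
    refine h.mul_eq_single j fun l hl => ?_
    rcases lt_or_gt_of_ne hl with hl | hl
    · exact Or.inl (hcol l hl)
    · right
      rw [← mul_assoc]
      exact h.upper l j' (by rw [Fin.le_def]; simp only [j']; omega)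
  refine h.cancel j j' rfl _ ?_
  rw [mul_assoc _ N, ← h3, h1, h2]

lemma commute_pow (hA : (D + N) * A = A * (D + N)) (k : ℕ) :
    (D + N) * A ^ k = A ^ k * (D + N) :=
  ((show Commute (D + N) A from hA).pow_right k).eq

/-- By upper triangularity, diagonal entries of powers of `A` are powers of diagonal entries. These
are therefore nilpotent; they commute with `D`, so `reduced` applies. -/
lemma corner_eq_zero_of_nilpotent (h : IsFlagModel P D N) (hN : IsNilpotent N)
    (hA : (D + N) * A = A * (D + N)) (hAn : IsNilpotent A) {i j : Fin n} (hji : j ≤ i) :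
    P i * A * P j = 0 := by
  rcases hji.lt_or_eq with hji | rfl
  · exact h.corner_eq_zero_of_commute hN hA hji
  have hsupp : P j * (P j * A * P j) * P j = P j * A * P j := by
    simp only [mul_assoc, h.idem]
    simp only [← mul_assoc, h.idem]
  refine h.reduced j _ hsupp ?_ ?_
  · rw [h.lie_corner]
    exact h.lie_corner_eq_zero (h.lie_nilpotent hN hA) le_rfl
  · have hpow : ∀ k, (P j * A * P j) ^ (k + 1) = P j * A ^ (k + 1) * P j := by
      intro k
      induction k with
      | zero => simp
      | succ k ih =>
        have h1 : P j * A ^ (k + 1 + 1) * P j = P j * A ^ (k + 1) * (A * P j) := by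
          rw [pow_succ A (k + 1)]; simp only [mul_assoc]
        rw [pow_succ, ih, h1]
        rw [h.mul_eq_single (a := P j * A ^ (k + 1)) (b := A * P j) j]
        · simp only [mul_assoc]
          rw [← mul_assoc (P j) (P j), h.idem]
        · intro l hl
          rcases lt_or_gt_of_ne hl with hl | hl
          · exact Or.inl (h.corner_eq_zero_of_commute hN (commute_pow hA _) hl)
          · right
            rw [← mul_assoc]
            exact h.corner_eq_zero_of_commute hN hA hl
    obtain ⟨m, hm⟩ := hAn
    exact ⟨m + 1, by rw [hpow, pow_succ, hm]; simp⟩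

lemma corner_pow_eq_zero (h : IsFlagModel P D N)
    (hA : ∀ i j, j ≤ i → P i * A * P j = 0) (m : ℕ) (i j : Fin n) (hji : (j : ℕ) < i + m) :
    P i * A ^ m * P j = 0 := by
  induction m generalizing i with
  | zero => rw [pow_zero, mul_one]; exact h.ortho i j (by rintro rfl; omega)
  | succ m ih =>
    rw [pow_succ', ← mul_assoc, mul_assoc]
    refine h.mul_eq_zero_of_forall fun l => ?_
    rcases le_or_gt l i with hl | hl
    · exact Or.inl (hA i l hl)
    · right
      rw [← mul_assoc]
      exact ih l (by rw [Fin.lt_def] at hl; omega)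

lemma mul_pow_eq_zero (h : IsFlagModel P D N)
    (hA : ∀ i j, j ≤ i → P i * A * P j = 0) (m : ℕ) (i : Fin n) (hi : n ≤ i + m) :
    P i * A ^ m = 0 := by
  rw [← mul_one (P i * A ^ m)]
  refine h.mul_eq_zero_of_forall fun l => Or.inl ?_
  exact h.corner_pow_eq_zero hA m i l (by omega)

lemma isNilpotent (h : IsFlagModel P D N) : IsNilpotent N := by
  refine ⟨n, ?_⟩
  rw [← one_mul (N ^ n)]
  exact h.mul_eq_zero_of_forall fun l => Or.inr (h.mul_pow_eq_zero h.upper n l (by omega))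

/-- The range of `N ^ m` is dense in the sum of the first `n - m` summands. -/
lemma mul_eq_zero_of_mul_pow (h : IsFlagModel P D N) {Y : R} {m : ℕ} (hY : Y * N ^ m = 0)
    (l : Fin n) (hl : (l : ℕ) + m < n) : Y * P l = 0 := by
  induction m generalizing Y l with
  | zero => rw [pow_zero, mul_one] at hY; simp [hY]
  | succ m ih =>
    rw [pow_succ', ← mul_assoc] at hY
    induction hc : (l : ℕ) using Nat.strong_induction_on generalizing l with
    | _ c ihc =>
    let l' : Fin n := ⟨l + 1, by omega⟩
    have h1 : Y * N * P l' = 0 := ih hY l' (by simp only [l']; omega)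
    refine h.cancel l l' rfl _ ?_
    rw [← h1, mul_assoc, mul_assoc Y N]
    symm
    refine h.mul_eq_single l fun k hk => ?_
    rcases lt_or_gt_of_ne hk with hk | hk
    · exact Or.inl (ihc k (by omega) k (by omega) rfl)
    · right
      rw [← mul_assoc]
      exact h.upper k l' (by rw [Fin.le_def]; simp only [l']; omega)

/-- Invertible intertwiners are upper triangular. -/
theorem corner_intertwiner_eq_zero {P' : Fin n → R} {D' N' : R} (h : IsFlagModel P D N)
    (h' : IsFlagModel P' D' N') (W : Rˣ) (hW : (W : R) * (D' + N') = (D + N) * W)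
    {k j : Fin n} (hjk : j < k) : P k * W * P' j = 0 := by
  have hT : D + N = W * (D' + N') * (W⁻¹ : Rˣ) := by
    rw [hW, mul_assoc, Units.mul_inv, mul_one]
  set A : R := W * N' * (W⁻¹ : Rˣ) with hAdef
  have hpow : ∀ m, A ^ m = W * N' ^ m * (W⁻¹ : Rˣ) := fun m => by
    induction m with
    | zero => simp
    | succ m ih => rw [pow_succ, ih, hAdef, pow_succ]; simp [mul_assoc]
  have hA : (D + N) * A = A * (D + N) := by
    rw [hT, hAdef]
    have : (D' + N') * N' = N' * (D' + N') := by rw [add_mul, mul_add, h'.commute]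
    calc _ = (W : R) * ((D' + N') * N') * (W⁻¹ : Rˣ) := by simp [mul_assoc]
      _ = _ := by rw [this]; simp [mul_assoc]
  have hAn : IsNilpotent A := by
    obtain ⟨m, hm⟩ := h'.isNilpotent
    exact ⟨m, by rw [hpow, hm]; simp⟩
  have hU : ∀ i j, j ≤ i → P i * A * P j = 0 := fun i j hij =>
    h.corner_eq_zero_of_nilpotent h.isNilpotent hA hAn hij
  -- The exponent `m = n - 1 - j` is the largest with `j + m < n`, and `j < k` gives `n ≤ k + m`, so
  -- `P k * A ^ m = 0`.
  refine h'.mul_eq_zero_of_mul_pow (m := n - 1 - j) ?_ j (by omega)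
  have h1 : P k * A ^ (n - 1 - j : ℕ) = 0 :=
    h.mul_pow_eq_zero hU _ k (by rw [Fin.lt_def] at hjk; omega)
  rw [hpow] at h1
  have h2 : P k * W * N' ^ (n - 1 - j : ℕ) * (W⁻¹ : Rˣ) = 0 := by
    rw [← h1]; simp only [mul_assoc]
  simpa using congrArg (· * (W : R)) h2

end IsFlagModel

/-! ### The Kleinecke-Shirokov theorem for eigenvalues -/

open Topology Filter

/-- The Kleinecke-Shirokov theorem, for eigenvalues: a commutator `[d, a]` that commutes with `d`
has no nonzero eigenvalue. -/
theorem eigenvalue_lie_eq_zero {E : Type*} [NormedAddCommGroup E] [NormedSpace ℂ E]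
    {d a : E →L[ℂ] E} (h : ⁅d, ⁅d, a⁆⁆ = 0) {v : E} {z : ℂ} (hv : v ≠ 0)
    (hz : ⁅d, a⁆ v = z • v) : z = 0 := by
  set c := ⁅d, a⁆ with hc
  have hleib : ∀ x y : E →L[ℂ] E, ⁅d, x * y⁆ = ⁅d, x⁆ * y + x * ⁅d, y⁆ := fun x y => by
    simp only [Ring.lie_def]; noncomm_ring
  have hck : ∀ k, ⁅d, c ^ k⁆ = 0 := fun k => by
    rw [Ring.lie_def, sub_eq_zero] at h ⊢
    exact ((show Commute d c from h).pow_right k).eq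
  let δ := LieAlgebra.ad ℤ (E →L[ℂ] E) d
  have hδ : ∀ x, δ x = ⁅d, x⁆ := fun x => rfl
  have hsucc : ∀ k x, (δ ^ (k + 1)) x = ⁅d, (δ ^ k) x⁆ := fun k x => by
    rw [pow_succ', Module.End.mul_apply, hδ]
  -- Since `[d, c] = 0`, only two terms of the Leibniz expansion survive.
  have hmul : ∀ k x, (δ ^ (k + 1)) (x * a) = (δ ^ (k + 1)) x * a + (k + 1) • ((δ ^ k) x * c) := by
    intro k x
    induction k with
    | zero => simp [hδ, hleib, hc]
    | succ k ih =>
      rw [hsucc, ih, lie_add, hleib, lie_nsmul, hleib, h, ← hsucc, ← hsucc, ← hc, mul_zero,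
        add_zero, succ_nsmul _ (k + 1)]
      abel
  have hfact : ∀ k, (δ ^ k) (a ^ k) = k.factorial • c ^ k := by
    intro k
    induction k with
    | zero => simp
    | succ k ih =>
      rw [pow_succ a, hmul, hsucc, ih, lie_nsmul, hck, smul_zero, zero_mul, zero_add,
        Nat.factorial_succ, mul_smul, smul_mul_assoc, ← pow_succ]
  have hnorm : ∀ k x, ‖(δ ^ k) x‖ ≤ (2 * ‖d‖) ^ k * ‖x‖ := by
    intro k x
    induction k with
    | zero => simp
    | succ k ih =>
      rw [hsucc, Ring.lie_def]
      calc _ ≤ ‖d‖ * ‖(δ ^ k) x‖ + ‖(δ ^ k) x‖ * ‖d‖ :=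
            (norm_sub_le _ _).trans (add_le_add (norm_mul_le _ _) (norm_mul_le _ _))
        _ = 2 * ‖d‖ * ‖(δ ^ k) x‖ := by ring
        _ ≤ 2 * ‖d‖ * ((2 * ‖d‖) ^ k * ‖x‖) := by gcongr
        _ = _ := by ring
  have hcv : ∀ k, (c ^ k) v = z ^ k • v := by
    intro k
    induction k with
    | zero => simp
    | succ k ih =>
      rw [pow_succ, mul_apply_eq_comp, hz, map_smul, ih, smul_smul, pow_succ, mul_comm]
  -- Apply `δ ^ k (a ^ k) = k! c ^ k` to `v` and compare norms: the factorial beats every geometric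
  -- sequence.
  have hle : ∀ k : ℕ, ‖z‖ ^ k ≤ (2 * ‖d‖ * ‖a‖) ^ k * ‖(1 : E →L[ℂ] E)‖ / k.factorial := by
    intro k
    have hak : ‖a ^ k‖ ≤ ‖a‖ ^ k * ‖(1 : E →L[ℂ] E)‖ := by
      induction k with
      | zero => simp
      | succ k ih =>
        calc ‖a ^ (k + 1)‖ ≤ ‖a‖ * ‖a ^ k‖ := by rw [pow_succ']; exact norm_mul_le _ _
          _ ≤ ‖a‖ * (‖a‖ ^ k * ‖(1 : E →L[ℂ] E)‖) := by gcongr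
          _ = _ := by ring
    have hpos : (0 : ℝ) < k.factorial := by exact_mod_cast k.factorial_pos
    rw [le_div_iff₀ hpos]
    refine le_of_mul_le_mul_right ?_ (norm_pos_iff.mpr hv)
    calc ‖z‖ ^ k * k.factorial * ‖v‖ = ‖(k.factorial • c ^ k) v‖ := by
          rw [smul_apply, hcv, ← Nat.cast_smul_eq_nsmul ℂ, norm_smul, norm_smul,
            norm_pow]
          simp; ring
      _ ≤ ‖(δ ^ k) (a ^ k)‖ * ‖v‖ := by rw [← hfact]; exact ContinuousLinearMap.le_opNorm _ _
      _ ≤ (2 * ‖d‖) ^ k * (‖a‖ ^ k * ‖(1 : E →L[ℂ] E)‖) * ‖v‖ := by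
          gcongr
          exact (hnorm k _).trans (by gcongr)
      _ = _ := by rw [mul_pow]; ring
  by_contra hz0
  have hzpos : 0 < ‖z‖ := norm_pos_iff.mpr hz0
  have ht := (FloorSemiring.tendsto_pow_div_factorial_atTop (2 * ‖d‖ * ‖a‖ / ‖z‖)).mul_const
    ‖(1 : E →L[ℂ] E)‖
  rw [zero_mul] at ht
  obtain ⟨k, hk⟩ := (ht.eventually (gt_mem_nhds zero_lt_one)).exists
  have := hle k
  rw [div_pow] at hk
  have h1 : (2 * ‖d‖ * ‖a‖) ^ k * ‖(1 : E →L[ℂ] E)‖ / k.factorial =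
      ((2 * ‖d‖ * ‖a‖) ^ k / ‖z‖ ^ k / k.factorial * ‖(1 : E →L[ℂ] E)‖) * ‖z‖ ^ k := by
    field_simp
  rw [h1] at this
  have hzk : 0 < ‖z‖ ^ k := by positivity
  nlinarith

/-! ### Eigenvectors and intertwiners of Cowen-Douglas operators -/

namespace IsCowenDouglas

variable {E F G : Type*} [NormedAddCommGroup E] [NormedSpace ℂ E] [NormedAddCommGroup F]
  [NormedSpace ℂ F] [NormedAddCommGroup G] [NormedSpace ℂ G] {Ω : Set ℂ} {n : ℕ}
  {T : E →L[ℂ] E} {S : F →L[ℂ] F}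

lemma mem_ker_sub_iff {w : ℂ} {v : E} :
    v ∈ LinearMap.ker (T - w • ContinuousLinearMap.id ℂ E).toLinearMap ↔ T v = w • v := by
  simp [sub_eq_zero]

lemma exists_eigenvector (hT : IsCowenDouglas Ω 1 T) {w : ℂ} (hw : w ∈ Ω) :
    ∃ v : E, v ≠ 0 ∧ T v = w • v ∧ ∀ u, T u = w • u → ∃ r : ℂ, u = r • v := by
  obtain ⟨v, hv0, hv⟩ := rank_eq_one_iff.mp ((hT.rank_ker w hw).trans Nat.cast_one)
  refine ⟨v, by simpa using hv0, mem_ker_sub_iff.mp v.2, fun u hu => ?_⟩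
  obtain ⟨r, hr⟩ := hv ⟨u, mem_ker_sub_iff.mpr hu⟩
  exact ⟨r, (congrArg Subtype.val hr).symm⟩

lemma eq_zero_of_forall_eigenvector (hT : IsCowenDouglas Ω n T) {Y : E →L[ℂ] G}
    (hY : ∀ w ∈ Ω, ∀ v, T v = w • v → Y v = 0) : Y = 0 := by
  have h1 : (⨆ w ∈ Ω, LinearMap.ker (T - w • ContinuousLinearMap.id ℂ E).toLinearMap) ≤
      LinearMap.ker Y.toLinearMap :=
    iSup₂_le fun w hw v hv => hY w hw v (mem_ker_sub_iff.mp hv)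
  have h2 := Submodule.topologicalClosure_minimal _ h1 Y.isClosed_ker
  rw [hT.span_ker] at h2
  ext v
  exact h2 (Submodule.mem_top (x := v))

/-- A bounded right inverse of `T - w`. -/
lemma exists_rightInverse [CompleteSpace E] (hT : IsCowenDouglas Ω n T) {w : ℂ} (hw : w ∈ Ω) :
    ∃ R : E →L[ℂ] E, (T - w • ContinuousLinearMap.id ℂ E) ∘L R = ContinuousLinearMap.id ℂ E := by
  set A := T - w • ContinuousLinearMap.id ℂ E with hA
  have hfin : Module.Finite ℂ (LinearMap.ker A.toLinearMap) :=
    Module.rank_lt_aleph0_iff.mp (by rw [hT.rank_ker w hw]; exact Cardinal.natCast_lt_aleph0)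
  obtain ⟨p, hp⟩ := Submodule.ClosedComplemented.of_finiteDimensional (𝕜 := ℂ)
    (LinearMap.ker A.toLinearMap)
  -- Pairing a projection onto the finite-dimensional kernel with `A` gives an isomorphism; its
  -- inverse on the second factor is the right inverse.
  let B : E →L[ℂ] LinearMap.ker A.toLinearMap × E := p.prod A
  have hinj : LinearMap.ker B.toLinearMap = ⊥ := by
    rw [LinearMap.ker_eq_bot']
    intro x hx
    have h1 : p x = 0 := congrArg Prod.fst hx
    have h2 : A x = 0 := congrArg Prod.snd hx
    have := hp ⟨x, h2⟩
    rw [h1] at this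
    exact (congrArg Subtype.val this).symm
  have hsurj : LinearMap.range B.toLinearMap = ⊤ := by
    rw [LinearMap.range_eq_top]
    rintro ⟨k, y⟩
    obtain ⟨x, rfl⟩ := hT.surjective w hw y
    refine ⟨x + ((k - p x : LinearMap.ker A.toLinearMap) : E), ?_⟩
    have h1 : A ((k - p x : LinearMap.ker A.toLinearMap) : E) = 0 := (k - p x).2
    ext1
    · change p (x + _) = k
      rw [map_add, hp]; abel
    · change A (x + _) = A x
      rw [map_add, h1, add_zero]
  let e := ContinuousLinearEquiv.ofBijective B hinj hsurj
  refine ⟨e.symm.toContinuousLinearMap ∘L ContinuousLinearMap.inr ℂ _ E, ?_⟩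
  ext y
  have : B (e.symm (0, y)) = (0, y) := e.apply_symm_apply (0, y)
  exact congrArg Prod.snd this

/-- Every eigenvector extends to a local holomorphic section of eigenvectors. -/
lemma exists_analyticAt_section [CompleteSpace E] (hT : IsCowenDouglas Ω n T) {w₀ : ℂ}
    (hw : w₀ ∈ Ω) {v : E} (hv : T v = w₀ • v) :
    ∃ e : ℂ → E, AnalyticAt ℂ e w₀ ∧ e w₀ = v ∧ ∀ᶠ w in 𝓝 w₀, T (e w) = w • e w := by
  obtain ⟨R, hR⟩ := hT.exists_rightInverse hw
  -- Since `(T - w₀) R = 1`, one has `T - w = (T - w₀) g(w)`, so `g(w)⁻¹ v` is an eigenvector at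
  -- `w`.
  let g : ℂ → (E →L[ℂ] E) := fun w => 1 - (w - w₀) • R
  have hg : AnalyticAt ℂ g w₀ := by
    have : AnalyticAt ℂ (fun w : ℂ => (w - w₀) • R) w₀ :=
      (analyticAt_id.sub analyticAt_const).smul analyticAt_const
    exact analyticAt_const.sub this
  have hg0 : g w₀ = ((1 : (E →L[ℂ] E)ˣ) : E →L[ℂ] E) := by simp [g]
  have hinv : AnalyticAt ℂ (fun w => Ring.inverse (g w)) w₀ := by
    refine AnalyticAt.comp (g := Ring.inverse) ?_ hg
    rw [hg0]
    exact analyticAt_inverse _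
  refine ⟨fun w => Ring.inverse (g w) v, ?_, ?_, ?_⟩
  · exact ((ContinuousLinearMap.apply ℂ E v).analyticAt _).comp hinv
  · simp [g]
  · have hunit : ∀ᶠ w in 𝓝 w₀, IsUnit (g w) := by
      refine hg.continuousAt.eventually ?_
      rw [hg0]
      exact Units.isOpen.mem_nhds (Units.isUnit _)
    filter_upwards [hunit] with w hwu
    set u := Ring.inverse (g w) v with hu
    have h1 : g w u = v := by
      rw [hu, ← mul_apply_eq_comp, Ring.mul_inverse_cancel _ hwu,
        one_apply_eq_self]
    have h2 : u = v + (w - w₀) • R u := by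
      rw [← h1]
      simp [g]
    have h3 : T (R u) = u + w₀ • R u := by
      have := congrArg (fun f : E →L[ℂ] E => f u) hR
      simpa [sub_eq_iff_eq_add] using this
    have h4 : T u = w₀ • v + (w - w₀) • (u + w₀ • R u) := by
      conv_lhs => rw [h2]
      rw [map_add, map_smul, h3, hv]
    have h5 : v = u - (w - w₀) • R u := eq_sub_of_add_eq h2.symm
    rw [h4, h5]
    module

/-- The eigenvectors over a neighbourhood of a single point span a dense subspace. -/
lemma eq_zero_of_eventually_eigenvector [CompleteSpace E] (hT : IsCowenDouglas Ω 1 T)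
    (hΩo : IsOpen Ω) (hΩc : IsPreconnected Ω) {Y : E →L[ℂ] G} {w₀ : ℂ} (hw₀ : w₀ ∈ Ω)
    (hY : ∀ᶠ w in 𝓝 w₀, ∀ v, T v = w • v → Y v = 0) : Y = 0 := by
  let U : Set ℂ := {w | ∀ᶠ w' in 𝓝 w, ∀ v, T v = w' • v → Y v = 0}
  have hU : IsOpen U := isOpen_setOfPred_eventually_nhds
  have hsub : Ω ⊆ U := by
    refine hΩc.subset_of_closure_inter_subset hU ⟨w₀, hw₀, hY⟩ ?_
    rintro w₁ ⟨hcl, hw₁⟩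
    by_contra hnot
    obtain ⟨v, hv0, hv, -⟩ := hT.exists_eigenvector hw₁
    obtain ⟨e, hea, he0, hev⟩ := hT.exists_analyticAt_section hw₁ hv
    have hne : ∀ᶠ w in 𝓝 w₁, e w ≠ 0 :=
      hea.continuousAt.eventually_ne (by rw [he0]; exact hv0)
    have hYe : AnalyticAt ℂ (fun w => Y (e w)) w₁ := (Y.analyticAt _).comp hea
    -- Isolated zeros: either `Y ∘ e` vanishes near `w₁`, and `e w` spans the eigenline, or it has
    -- no zeros in a punctured neighbourhood, although `w₁` is a limit of points of `U`.
    rcases hYe.eventually_eq_zero_or_eventually_ne_zero with h0 | h0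
    · refine hnot ?_
      filter_upwards [hne, hev, h0, hΩo.mem_nhds hw₁] with w h1 h2 h3 h4 u hu
      obtain ⟨x, -, -, hx⟩ := hT.exists_eigenvector h4
      obtain ⟨r, hr⟩ := hx _ h2
      obtain ⟨s, rfl⟩ := hx _ hu
      have hr0 : r ≠ 0 := by rintro rfl; exact h1 (by rw [hr, zero_smul])
      have : Y x = 0 := by
        rw [hr, map_smul] at h3
        exact (smul_eq_zero.mp h3).resolve_left hr0
      rw [map_smul, this, smul_zero]
    · rw [eventually_nhdsWithin_iff] at h0
      obtain ⟨w, hwU, h1, h2⟩ := ((mem_closure_iff_frequently.mp hcl).and_eventually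
        (h0.and hev)).exists
      refine h1 ?_ (hwU.self_of_nhds _ h2)
      rintro rfl
      exact hnot hwU
  exact hT.eq_zero_of_forall_eigenvector fun w hw v hv => (hsub hw).self_of_nhds v hv

/-- A nonzero intertwiner of operators in `B_1(Ω)` has dense range. -/
theorem eq_zero_of_comp_eq_zero [CompleteSpace E] [CompleteSpace F] (hT : IsCowenDouglas Ω 1 T)
    (hS : IsCowenDouglas Ω 1 S) (hΩo : IsOpen Ω) (hΩc : IsPreconnected Ω) {B : F →L[ℂ] E}
    (hB : B ≠ 0) (hTB : T ∘L B = B ∘L S) {Y : E →L[ℂ] G} (hY : Y ∘L B = 0) : Y = 0 := by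
  have : ∃ w ∈ Ω, ∃ v, S v = w • v ∧ B v ≠ 0 := by
    by_contra! hcon
    exact hB (hS.eq_zero_of_forall_eigenvector hcon)
  obtain ⟨w₀, hw₀, v, hv, hBv⟩ := this
  -- Near `w₀`, `B` maps the section `e` of eigenvectors of `S` to nonzero eigenvectors of `T`.
  -- These span the eigenlines of `T` and are killed by `Y`.
  obtain ⟨e, hea, he0, hev⟩ := hS.exists_analyticAt_section hw₀ hv
  refine hT.eq_zero_of_eventually_eigenvector hΩo hΩc hw₀ ?_
  have hne : ∀ᶠ w in 𝓝 w₀, B (e w) ≠ 0 :=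
    (B.continuous.continuousAt.comp hea.continuousAt).eventually_ne
      (by rw [Function.comp_apply, he0]; exact hBv)
  filter_upwards [hne, hev, hΩo.mem_nhds hw₀] with w h1 h2 h3 u hu
  obtain ⟨x, -, -, hx⟩ := hT.exists_eigenvector h3
  have h4 : T (B (e w)) = w • B (e w) := by
    have := congrArg (fun f : F →L[ℂ] E => f (e w)) hTB
    simpa [h2] using this
  obtain ⟨r, hr⟩ := hx _ h4
  obtain ⟨s, rfl⟩ := hx _ hu
  have hr0 : r ≠ 0 := by rintro rfl; exact h1 (by rw [hr, zero_smul])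
  have h5 : Y (B (e w)) = 0 := congrArg (fun f : F →L[ℂ] G => f (e w)) hY
  rw [hr, map_smul] at h5
  rw [map_smul, (smul_eq_zero.mp h5).resolve_left hr0, smul_zero]

end IsCowenDouglas

/-! ### From operator matrices to flag models -/

section Blocks

variable {H : Type*} [NormedAddCommGroup H] [InnerProductSpace ℂ H] {n : ℕ}
  {Ω : Set ℂ} {P Q : Fin n → H →L[ℂ] H} {T A : H →L[ℂ] H}

lemma block_eq_zero_iff {k j : Fin n} : block Q P A k j = 0 ↔ Q k * A * P j = 0 := by
  constructor
  · intro h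
    ext x
    exact congrArg Subtype.val
      (congrArg (fun f : Summand P j →L[ℂ] Summand Q k => f ⟨P j x, x, rfl⟩) h)
  · intro h
    ext ⟨_, x, rfl⟩
    exact congrArg (fun f : H →L[ℂ] H => f x) h

namespace IsDirectDecomposition

lemma apply_of_mem (hP : IsDirectDecomposition P) {j : Fin n} {x : H} (hx : x ∈ Summand P j) :
    P j x = x := by
  obtain ⟨y, rfl⟩ := hx
  exact congrArg (fun f : H →L[ℂ] H => f y) (hP.idem j)

lemma completeSpace_summand [CompleteSpace H] (hP : IsDirectDecomposition P) (j : Fin n) :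
    CompleteSpace (Summand P j) := by
  have h1 : Summand P j = LinearMap.ker (1 - P j : H →L[ℂ] H).toLinearMap := by
    ext x
    constructor
    · intro hx
      change x - P j x = 0
      rw [hP.apply_of_mem hx, sub_self]
    · intro hx
      exact ⟨x, (sub_eq_zero.mp hx).symm⟩
  have h2 : IsClosed (Summand P j : Set H) := by
    rw [h1]; exact (1 - P j : H →L[ℂ] H).isClosed_ker
  exact h2.completeSpace_coe

lemma diagPart_mul (hP : IsDirectDecomposition P) (j : Fin n) :
    diagPart P T * P j = P j * T * P j := by
  rw [diagPart, Finset.sum_mul, Finset.sum_eq_single j]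
  · rw [mul_assoc _ (P j), hP.idem]
  · intro k _ hk
    rw [mul_assoc _ (P k), hP.ortho k j hk, mul_zero]
  · simp

lemma mul_diagPart (hP : IsDirectDecomposition P) (j : Fin n) :
    P j * diagPart P T = P j * T * P j := by
  rw [diagPart, Finset.mul_sum, Finset.sum_eq_single j]
  · rw [← mul_assoc, ← mul_assoc, hP.idem]
  · intro k _ hk
    rw [← mul_assoc, ← mul_assoc, hP.ortho j k hk.symm, zero_mul, zero_mul]
  · simp

end IsDirectDecomposition

namespace IsCFB

/-- The eigenspaces of `T_{i,i}` over `Ω` are lines, so `A` acts on each by a scalar, which is an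
eigenvalue of `A` and hence `0`; these lines span the summand. -/
lemma eq_zero_of_diagPart_commute (hT : IsCFB Ω P T) {i : Fin n}
    (hA : P i * A * P i = A) (hDA : ⁅diagPart P T, A⁆ = 0)
    (hz : ∀ (z : ℂ) (v : H), v ≠ 0 → A v = z • v → z = 0) : A = 0 := by
  have hP := hT.decomposition
  have hblock : ∀ x : Summand P i, (block P P T i i x : H) = diagPart P T x := by
    intro x
    have h1 : (block P P T i i x : H) = P i (T x) := rfl
    have h2 := congrArg (fun f : H →L[ℂ] H => f x) (hP.diagPart_mul (T := T) i)
    simp only [mul_apply_eq_comp, hP.apply_of_mem x.2] at h2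
    rw [h1, h2]
  have hmem : ∀ x, A x ∈ Summand P i := fun x => by
    rw [← hA]; exact ⟨A (P i x), rfl⟩
  have h0 : A ∘L (Summand P i).subtypeL = 0 := by
    refine (hT.diag_cowenDouglas i).eq_zero_of_forall_eigenvector fun w hw v hv => ?_
    obtain ⟨x, hx0, hx, hxu⟩ := (hT.diag_cowenDouglas i).exists_eigenvector hw
    have hDx : diagPart P T x = w • (x : H) := by rw [← hblock, hx]; rfl
    have hDAx : diagPart P T (A x) = w • A x := by
      rw [Ring.lie_def, sub_eq_zero] at hDA
      have := congrArg (fun f : H →L[ℂ] H => f x) hDA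
      simpa [hDx] using this
    obtain ⟨z, hzx⟩ := hxu ⟨A x, hmem x⟩ (Subtype.ext ((hblock _).trans hDAx))
    have hzx' : A x = z • (x : H) := congrArg Subtype.val hzx
    have hz0 := hz z x (by simpa using hx0) hzx'
    obtain ⟨r, rfl⟩ := hxu v hv
    change A (r • (x : H)) = 0
    rw [map_smul, hzx', hz0, zero_smul, smul_zero]
  ext x
  rw [← hA]
  have := congrArg (fun f : Summand P i →L[ℂ] H => f ⟨P i x, x, rfl⟩) h0
  change P i (A (P i x)) = 0
  rw [show A (P i x) = 0 from this, map_zero]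

/-- The `(i, j)` entry of the relation between `T` and its diagonal says that `T_{i,j}` intertwines
`T_{i,i}` and `T_{j,j}`; being nonzero, it has dense range. -/
lemma eq_zero_of_mul_block_eq_zero [CompleteSpace H] (hT : IsCFB Ω P T) (hΩo : IsOpen Ω)
    (hΩc : IsPreconnected Ω) {i j : Fin n} (hij : P i * T * P j ≠ 0) {Y : H →L[ℂ] H}
    (hY : Y * P i * T * P j = 0) : Y * P i = 0 := by
  have hP := hT.decomposition
  have := hP.completeSpace_summand i
  have := hP.completeSpace_summand j
  have hcomm : P i * T * P i * T * P j = P i * T * P j * T * P j := by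
    have := congrArg (fun f => P i * f * P j) hT.diag_commute
    simp only [← mul_assoc] at this
    rw [hP.mul_diagPart] at this
    rw [this, mul_assoc (P i * T), hP.diagPart_mul]
    simp only [mul_assoc]
  have hint : block P P T i i ∘L block P P T i j = block P P T i j ∘L block P P T j j := by
    ext ⟨_, x, rfl⟩
    exact congrArg (fun f : H →L[ℂ] H => f x) hcomm
  have h0 : (Y ∘L (Summand P i).subtypeL) = 0 := by
    refine (hT.diag_cowenDouglas i).eq_zero_of_comp_eq_zero (hT.diag_cowenDouglas j) hΩo hΩc
      (fun h => hij (block_eq_zero_iff.mp h)) hint ?_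
    ext ⟨_, x, rfl⟩
    exact congrArg (fun f : H →L[ℂ] H => f x) hY
  ext x
  exact congrArg (fun f : Summand P i →L[ℂ] H => f ⟨P i x, x, rfl⟩) h0

/-- If the superdiagonal entries do not vanish, then `P`, `diagPart P T` and the
strictly upper triangular part of `T` satisfy `IsFlagModel`. -/
theorem isFlagModel [CompleteSpace H] (hT : IsCFB Ω P T) (hΩo : IsOpen Ω)
    (hΩc : IsPreconnected Ω)
    (hne : ∀ i j : Fin n, (j : ℕ) = i + 1 → P i * T * P j ≠ 0) :
    IsFlagModel P (diagPart P T) (T - diagPart P T) := by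
  have hP := hT.decomposition
  have hoff : ∀ i j, i ≠ j → P i * diagPart P T * P j = 0 := fun i j hij => by
    rw [hP.mul_diagPart, mul_assoc, hP.ortho i j hij, mul_zero]
  refine ⟨hP.idem, hP.ortho, hP.sum_eq, fun j => ?_, ?_, fun i j hji => ?_, fun i j hij Y hY => ?_,
    fun i a ha hDa => ?_, fun i a ha hDa hnil => ?_⟩
  · rw [hP.diagPart_mul, hP.mul_diagPart]
  · rw [mul_sub, sub_mul, hT.diag_commute]
  · rw [mul_sub, sub_mul]
    rcases hji.lt_or_eq with hji | rfl
    · rw [hoff i j hji.ne', block_eq_zero_iff.mp (hT.upper i j hji), sub_zero]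
    · rw [hP.mul_diagPart, mul_assoc _ (P j), hP.idem, sub_self]
  · refine hT.eq_zero_of_mul_block_eq_zero hΩo hΩc (hne i j hij) ?_
    rw [mul_sub, sub_mul, sub_eq_zero] at hY
    rw [hY, mul_assoc Y, mul_assoc Y, hoff i j (by rintro rfl; omega), mul_zero]
  · refine hT.eq_zero_of_diagPart_commute (i := i) ?_ hDa fun z v hv hz =>
      eigenvalue_lie_eq_zero hDa hv hz
    have hD : diagPart P T * P i = P i * diagPart P T := by
      rw [hP.diagPart_mul, hP.mul_diagPart]
    rw [Ring.lie_def, mul_sub, sub_mul]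
    congr 1
    · rw [← mul_assoc, ← hD]
      nth_rw 2 [← ha]
      simp only [mul_assoc]
    · nth_rw 2 [← ha]
      simp only [mul_assoc, hD]
  · refine hT.eq_zero_of_diagPart_commute ha hDa fun z v hv hz => ?_
    obtain ⟨m, hm⟩ := hnil
    have hpow : ∀ k, (a ^ k) v = z ^ k • v := fun k => by
      induction k with
      | zero => simp
      | succ k ih =>
        rw [pow_succ, mul_apply_eq_comp, hz, map_smul, ih, smul_smul, pow_succ, mul_comm]
    have := hpow m
    rw [hm, zero_apply, eq_comm, smul_eq_zero] at this
    exact eq_zero_of_pow_eq_zero (this.resolve_right hv)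

lemma superdiagProd_eq_zero {k : Fin n} {i j : Fin n}
    (hij : (j : ℕ) = i + 1) (hzero : block P P T i j = 0) (hki : k ≤ i) :
    ∀ (m : ℕ) (h : (k : ℕ) + m < n), (j : ℕ) ≤ k + m → superdiagProd P T k m h = 0 := by
  intro m
  induction m with
  | zero => intro h hj; rw [Fin.le_def] at hki; omega
  | succ m ih =>
    intro h hj
    rw [superdiagProd]
    rcases hj.lt_or_eq with hj | hj
    · rw [ih _ (by omega), ContinuousLinearMap.zero_comp]
    · obtain rfl : j = ⟨(k : ℕ) + (m + 1), h⟩ := Fin.ext hj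
      obtain rfl : i = ⟨(k : ℕ) + m, Nat.lt_of_succ_lt h⟩ :=
        Fin.ext (by simp only at hij ⊢; omega)
      rw [hzero, ContinuousLinearMap.comp_zero]

/-- The superdiagonal entries of a strongly irreducible operator do not vanish. -/
theorem superdiag_ne_zero (hT : IsCFB Ω P T) (hΩ : Ω.Nonempty) (hirr : IsStronglyIrreducible T)
    (i j : Fin n) (hij : (j : ℕ) = i + 1) : P i * T * P j ≠ 0 := by
  have hP := hT.decomposition
  intro hzero
  -- Each such entry has the zero entry as a factor, so the idempotent onto the first summands, up
  -- to `i`, commutes with `T`.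
  have hentry : ∀ k l : Fin n, k ≤ i → i < l → P k * T * P l = 0 := by
    intro k l hk hl
    rw [Fin.le_def] at hk
    rw [Fin.lt_def] at hl
    obtain ⟨C, -, hC⟩ := hT.entry k (l - k) (by omega)
    rw [superdiagProd_eq_zero hij (block_eq_zero_iff.mpr hzero) hk _ _ (by omega),
      ContinuousLinearMap.comp_zero, block_eq_zero_iff] at hC
    have : (⟨(k : ℕ) + (l - k), by omega⟩ : Fin n) = l := Fin.ext (by simp only; omega)
    rwa [this] at hC
  set E : H →L[ℂ] H := ∑ k ∈ Finset.Iic i, P k with hE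
  have hEP : ∀ k ≤ i, E * P k = P k := fun k hk => by
    rw [hE, Finset.sum_mul, Finset.sum_eq_single k, hP.idem]
    · exact fun l _ hl => hP.ortho l k hl
    · simp [hk]
  have hEP' : ∀ k, i < k → E * P k = 0 := fun k hk => by
    rw [hE, Finset.sum_mul]
    refine Finset.sum_eq_zero fun l hl => hP.ortho l k ?_
    rintro rfl
    exact absurd (Finset.mem_Iic.mp hl) (not_le.mpr hk)
  have hPE : ∀ k ≤ i, P k * E = P k := fun k hk => by
    rw [hE, Finset.mul_sum, Finset.sum_eq_single k, hP.idem]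
    · exact fun l _ hl => hP.ortho k l hl.symm
    · simp [hk]
  have hPE' : ∀ k, i < k → P k * E = 0 := fun k hk => by
    rw [hE, Finset.mul_sum]
    refine Finset.sum_eq_zero fun l hl => hP.ortho k l ?_
    rintro rfl
    exact absurd (Finset.mem_Iic.mp hl) (not_le.mpr hk)
  have hidem : E * E = E := by
    conv_lhs => enter [2]; rw [hE]
    rw [Finset.mul_sum, hE]
    exact Finset.sum_congr rfl fun k hk => hEP k (Finset.mem_Iic.mp hk)
  have hext : ∀ A B : H →L[ℂ] H, (∀ k l, P k * A * P l = P k * B * P l) → A = B := by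
    intro A B hAB
    have hsum : ∀ A : H →L[ℂ] H, A = ∑ k, ∑ l, P k * A * P l := fun A => by
      simp_rw [← Finset.mul_sum, ← Finset.sum_mul, hP.sum_eq, one_mul, mul_one]
    rw [hsum A, hsum B]
    exact Finset.sum_congr rfl fun k _ => Finset.sum_congr rfl fun l _ => hAB k l
  have hcomm : E * T = T * E := by
    refine hext _ _ fun k l => ?_
    rw [← mul_assoc, ← mul_assoc, mul_assoc (P k * T)]
    rcases le_or_gt k i with hk | hk <;> rcases le_or_gt l i with hl | hl
    · rw [hPE k hk, hEP l hl]
    · rw [hPE k hk, hEP' l hl, mul_zero, hentry k l hk hl]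
    · rw [hPE' k hk, zero_mul, zero_mul, hEP l hl,
        block_eq_zero_iff.mp (hT.upper k l (hl.trans_lt hk))]
    · rw [hPE' k hk, hEP' l hl]; simp
  have hPne : ∀ k, P k ≠ 0 := by
    intro k hk
    obtain ⟨w, hw⟩ := hΩ
    obtain ⟨⟨_, x, rfl⟩, hv, -⟩ := (hT.diag_cowenDouglas k).exists_eigenvector hw
    exact hv (Subtype.ext (congrArg (fun f : H →L[ℂ] H => f x) hk))
  rcases hirr E hidem hcomm with h0 | h1
  · have := hEP i le_rfl
    rw [h0, zero_mul] at this
    exact hPne i this.symm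
  · have := hEP' j (by rw [Fin.lt_def]; omega)
    rw [h1, one_mul] at this
    exact hPne j this

/-- An invertible intertwiner of strongly irreducible operators is upper triangular. -/
theorem isUpperTriangular_of_intertwines [CompleteSpace H] {T' : H →L[ℂ] H}
    {P' : Fin n → H →L[ℂ] H} (hT : IsCFB Ω P T) (hT' : IsCFB Ω P' T') (hΩo : IsOpen Ω)
    (hΩc : IsConnected Ω) (hirr : IsStronglyIrreducible T) (hirr' : IsStronglyIrreducible T')
    (X : (H →L[ℂ] H)ˣ) (hX : (X : H →L[ℂ] H) * T = T' * (X : H →L[ℂ] H)) :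
    IsUpperTriangular P' P (X : H →L[ℂ] H) := by
  intro k j hjk
  rw [block_eq_zero_iff]
  refine (hT'.isFlagModel hΩo hΩc.isPreconnected
    (hT'.superdiag_ne_zero hΩc.nonempty hirr')).corner_intertwiner_eq_zero
    (hT.isFlagModel hΩo hΩc.isPreconnected (hT.superdiag_ne_zero hΩc.nonempty hirr)) X ?_ hjk
  rw [add_sub_cancel, add_sub_cancel, hX]

end IsCFB

/-- Strong irreducibility is invariant under similarity. -/
lemma IsStronglyIrreducible.of_similar {T' : H →L[ℂ] H} (hirr : IsStronglyIrreducible T)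
    (X : (H →L[ℂ] H)ˣ) (hX : (X : H →L[ℂ] H) * T = T' * (X : H →L[ℂ] H)) :
    IsStronglyIrreducible T' := by
  intro E hE hET
  set W : H →L[ℂ] H := ((X⁻¹ : (H →L[ℂ] H)ˣ) : H →L[ℂ] H) with hW
  have hXW : (X : H →L[ℂ] H) * W = 1 := X.mul_inv
  have hWX : W * (X : H →L[ℂ] H) = 1 := X.inv_mul
  have hTW : T * W = W * T' := by
    calc T * W = W * (X * T) * W := by rw [← mul_assoc, hWX, one_mul]
      _ = W * T' * (X * W) := by rw [hX]; simp only [mul_assoc]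
      _ = W * T' := by rw [hXW, mul_one]
  have hback : E = X * (W * E * X) * W := by
    calc E = (X * W) * E * (X * W) := by rw [hXW, one_mul, mul_one]
      _ = _ := by simp only [mul_assoc]
  have hidem : W * E * X * (W * E * X) = W * E * X := by
    calc W * E * X * (W * E * X) = W * E * (X * W) * E * X := by simp only [mul_assoc]
      _ = W * (E * E) * X := by rw [hXW, mul_one]; simp only [mul_assoc]
      _ = W * E * X := by rw [hE]
  have hcomm : W * E * X * T = T * (W * E * X) := by
    calc W * E * X * T = W * (E * T') * X := by rw [mul_assoc, hX]; simp only [mul_assoc]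
      _ = W * T' * E * X := by rw [hET]; simp only [mul_assoc]
      _ = T * (W * E * X) := by rw [← hTW]; simp only [mul_assoc]
  rcases hirr _ hidem hcomm with h | h
  · left; rw [hback, h]; simp
  · right; rw [hback, h, mul_one, hXW]

end Blocks

theorem proposition4p1 {H : Type*} [NormedAddCommGroup H] [InnerProductSpace ℂ H]
    [CompleteSpace H] [TopologicalSpace.SeparableSpace H] (hH : ¬ FiniteDimensional ℂ H)
    (n : ℕ) (Ω : Set ℂ) (hΩo : IsOpen Ω) (hΩb : Bornology.IsBounded Ω) (hΩc : IsConnected Ω)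
    (T T' : H →L[ℂ] H) (P P' : Fin n → H →L[ℂ] H)
    (hT : IsNCFB Ω P T) (hT' : IsNCFB Ω P' T')
    (hirr : IsStronglyIrreducible T)
    (X : (H →L[ℂ] H)ˣ)
    (hX : (X : H →L[ℂ] H) * T = T' * (X : H →L[ℂ] H)) :
    IsUpperTriangular P' P (X : H →L[ℂ] H) ∧
      IsUpperTriangular P P' ((X⁻¹ : (H →L[ℂ] H)ˣ) : H →L[ℂ] H) := by

  -- With both operators strongly irreducible the situation is symmetric, and `X⁻¹` intertwines them
  -- in the other direction.
  have hirr' := hirr.of_similar X hX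
  refine ⟨hT.cfb.isUpperTriangular_of_intertwines hT'.cfb hΩo hΩc hirr hirr' X hX,
    hT'.cfb.isUpperTriangular_of_intertwines hT.cfb hΩo hΩc hirr' hirr X⁻¹ ?_⟩
  rw [Units.inv_mul_eq_iff_eq_mul, ← mul_assoc, hX, mul_assoc, Units.mul_inv, mul_one]
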